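/- Let $k\ge 0$ be an integer and let $R=\{(x_1,\dots,x_k)\in\mathbb{R}^k : 0<x_1<\cdots<x_k<1\}$. For all positive real numbers $a_1,\dots,a_k$, the function $x\mapsto\det\bigl(x_i^{a_j-1}\bigr)_{1\le i,j\le k}$ is Lebesgue integrable on $R$, and $$\int_R \det\bigl(x_i^{a_j-1}\bigr)_{1\le i,j\le k}\,dx_1\cdots dx_k=\frac{\prod_{1\le i<j\le k}(a_j-a_i)}{\prod_{1\le i\le k}a_i\,\prod_{1\le i<j\le k}(a_i+a_j)}.$$ Moreover, for $a_j=j$ $(1\le j\le k)$ the integrand is equal on $R$ to the Vandermonde product $\prod_{1\le i<j\le k}(x_j-x_i)$; this product is integrable on $R$, and $$\int_R\prod_{1\le i<j\le k}(x_j-x_i)\,dx_1\cdots dx_k=\frac{\prod_{1\le i<j\le k}(j-i)}{\prod_{1\le i\le k}i\,\prod_{1\le i<j\le k}(i+j)}.$$ (Empty products and the empty determinant are $1$; for $k=0$ the domain is a single point of measure $1$.) -/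

import Mathlib

open MeasureTheory

/-- The open ordered simplex `0 < x_1 < ⋯ < x_k < 1` in `ℝ^k`. -/
def orderedSimplex (k : ℕ) : Set (Fin k → ℝ) :=
  {x | (∀ i, 0 < x i) ∧ StrictMono x ∧ ∀ i, x i < 1}

/-- The `k × k` matrix whose `(i, j)` entry is `x_i ^ (a_j - 1)` (a real power). -/
noncomputable def powerMatrix {k : ℕ} (a x : Fin k → ℝ) : Matrix (Fin k) (Fin k) ℝ :=
  Matrix.of fun i j => x i ^ (a j - 1)

/-!
Write `I(a; t)` for the integral of `det (x_i ^ (a_j - 1))` over `0 < x_1 < ⋯ < x_k < t`.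
Expanding the determinant along its last row and integrating the largest variable `x_k = s` last
turns each term into `∫₀ᵗ s ^ (a_l - 1) * I(a without a_l; s) ds`. By induction
`I(a without a_l; s)` is a multiple of `s ^ ∑_{j ≠ l} a_j`, so that `I(a; t) = t ^ (∑ a_j) F(a)`,
where
`(∑ a_j) * F(a) = ∑_l (-1) ^ (k - l) F(a without a_l)`.
This is `integral_det_powerMatrix_below`; the scale parameter `t` is what closes the induction.
Integrability is inherited from the product domain `(0, t) × {0 < x_1 < ⋯ < x_{k-1} < t}`, which
contains the region of integration and on which each term is a product of integrable factors.

The closed form (`pairRatio`) satisfies the same recursion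
(`sum_neg_one_pow_mul_pairRatio_succAbove`): for distinct `a_j`, after division by `F(a)` it reads
`∑_l a_l ∏_{j ≠ l} (a_l + a_j) / (a_l - a_j) = ∑_l a_l`,
which is the leading-coefficient form of Lagrange interpolation for the polynomial
`∏ (X + a_j) - ∏ (X - a_j)` at the nodes `a_l` (`sum_mul_prod_add_div_sub`). If two `a_j` agree,
the determinant and the closed form both vanish. For `a_j = j` the determinant is Vandermonde's.
-/

/-! ### The recursion for the closed form -/

/-- The closed form `∏_{i<j} (a_j - a_i) / (∏_i a_i * ∏_{i<j} (a_i + a_j))`. -/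
noncomputable def pairRatio {k : ℕ} (a : Fin k → ℝ) : ℝ :=
  (∏ i : Fin k, ∏ j ∈ Finset.Ioi i, (a j - a i)) /
    ((∏ i : Fin k, a i) * ∏ i : Fin k, ∏ j ∈ Finset.Ioi i, (a i + a j))

theorem prod_univ_erase_eq_prod_succAbove {k : ℕ} (f : Fin (k + 1) → ℝ) (l : Fin (k + 1)) :
    ∏ j ∈ Finset.univ.erase l, f j = ∏ i : Fin k, f (l.succAbove i) := by
  rw [← Finset.compl_singleton, ← Fin.image_succAbove_univ,
    Finset.prod_image (Fin.succAbove_right_injective.injOn)]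

/-- Separating the index `l` in a product over pairs `i < j`. -/
theorem prod_Ioi_eq_succAbove_mul {k : ℕ} (f : Fin (k + 1) → Fin (k + 1) → ℝ) (l : Fin (k + 1)) :
    ∏ i, ∏ j ∈ Finset.Ioi i, f i j =
      (∏ i : Fin k, ∏ j ∈ Finset.Ioi i, f (l.succAbove i) (l.succAbove j)) *
        ∏ i : Fin k, if l < l.succAbove i then f l (l.succAbove i) else f (l.succAbove i) l := by
  have key : ∀ {n : ℕ} (g : Fin n → Fin n → ℝ),
      ∏ i, ∏ j ∈ Finset.Ioi i, g i j = ∏ i, ∏ j, if i < j then g i j else 1 := by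
    intro n g
    refine Finset.prod_congr rfl fun i _ => ?_
    rw [← Finset.prod_filter]
    congr 1
    ext j
    simp
  rw [key, key, Fin.prod_univ_succAbove _ l]
  simp_rw [Fin.prod_univ_succAbove _ l, Fin.succAbove_lt_succAbove_iff]
  rw [if_neg (lt_irrefl l), one_mul, Finset.prod_mul_distrib, ← mul_assoc, mul_comm,
    ← Finset.prod_mul_distrib]
  congr 1
  refine Finset.prod_congr rfl fun i _ => ?_
  rcases lt_or_gt_of_ne (Fin.succAbove_ne l i) with h | h
  · simp [h, h.not_gt]
  · simp [h, h.not_gt]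

theorem prod_ite_le_neg_one {k l : ℕ} (h : l ≤ k) :
    (∏ i : Fin k, if l ≤ (i : ℕ) then (-1 : ℝ) else 1) = (-1) ^ (k + l) := by
  induction k with
  | zero => simp [Nat.le_zero.mp h]
  | succ k ih =>
    rcases h.lt_or_eq with h | rfl
    · rw [Fin.prod_univ_castSucc]
      simp only [Fin.val_castSucc, Fin.val_last]
      rw [ih (by omega), if_pos (by omega)]
      ring
    · rw [Even.neg_one_pow ⟨_, rfl⟩]
      exact Finset.prod_eq_one fun i _ => if_neg (by omega)

open Polynomial in
/-- Lagrange interpolation at the nodes `a_l` of the polynomial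
`∏ (X + a_i) - ∏ (X - a_i)`, whose coefficient of `X ^ k` is `2 ∑ a_i`. -/
theorem sum_mul_prod_add_div_sub {k : ℕ} {a : Fin (k + 1) → ℝ} (ha : Function.Injective a) :
    ∑ l, a l * ((∏ i : Fin k, (a l + a (l.succAbove i))) /
      ∏ i : Fin k, (a l - a (l.succAbove i))) = ∑ l, a l := by
  set P : ℝ[X] := ∏ i, (X - C (-a i)) - ∏ i, (X - C (a i)) with hP
  have hdeg : P.degree < (Finset.univ : Finset (Fin (k + 1))).card := by
    have hm : ∀ b : Fin (k + 1) → ℝ, (∏ i, (X - C (b i))).Monic := fun b =>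
      monic_prod_of_monic _ _ fun i _ => monic_X_sub_C _
    have hd : ∀ b : Fin (k + 1) → ℝ, (∏ i, (X - C (b i))).degree = ((k + 1 : ℕ) : WithBot ℕ) :=
      fun b => by
        rw [degree_prod]
        simp
    have := degree_sub_lt_left (p := ∏ i, (X - C (-a i))) (q := ∏ i, (X - C (a i)))
      (by rw [hd, hd]) (hm _).ne_zero (by rw [(hm _).leadingCoeff, (hm _).leadingCoeff])
    rw [hd] at this
    rwa [Finset.card_univ, Fintype.card_fin]
  have hc := Lagrange.coeff_eq_sum (v := a) ha.injOn hdeg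
  rw [hP, coeff_sub, prod_X_sub_C_coeff_card_pred _ _ (by simp),
    prod_X_sub_C_coeff_card_pred _ _ (by simp)] at hc
  have he : ∀ l, P.eval (a l) / ∏ j ∈ Finset.univ.erase l, (a l - a j) =
      2 * (a l * ((∏ i : Fin k, (a l + a (l.succAbove i))) /
        ∏ i : Fin k, (a l - a (l.succAbove i)))) := by
    intro l
    rw [prod_univ_erase_eq_prod_succAbove, hP, eval_sub, eval_prod, eval_prod,
      Fin.prod_univ_succAbove _ l, Fin.prod_univ_succAbove _ l]
    simp only [eval_sub, eval_X, eval_C, sub_neg_eq_add, sub_self, zero_mul, sub_zero]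
    ring
  rw [← hP] at hc
  simp only [he, ← Finset.mul_sum, Finset.sum_neg_distrib] at hc
  linarith

/-- Effect on the closed form of deleting `a_l`. The sign compensates for the pairs whose
difference occurs in `pairRatio a` as `a_j - a_l` instead of `a_l - a_j`. -/
theorem neg_one_pow_mul_pairRatio_succAbove {k : ℕ} {a : Fin (k + 1) → ℝ} (hpos : ∀ i, 0 < a i)
    (ha : Function.Injective a) (l : Fin (k + 1)) :
    (-1) ^ (k + l : ℕ) * pairRatio (fun i => a (l.succAbove i)) =
      pairRatio a * (a l * ((∏ i : Fin k, (a l + a (l.succAbove i))) /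
        ∏ i : Fin k, (a l - a (l.succAbove i)))) := by
  have hadd : ∏ i : Fin k, (if l < l.succAbove i then a l + a (l.succAbove i)
      else a (l.succAbove i) + a l) = ∏ i : Fin k, (a l + a (l.succAbove i)) :=
    Finset.prod_congr rfl fun i _ => by split_ifs <;> ring
  have hsub : ∏ i : Fin k, (if l < l.succAbove i then a (l.succAbove i) - a l
      else a l - a (l.succAbove i)) =
      (-1) ^ (k + l : ℕ) * ∏ i : Fin k, (a l - a (l.succAbove i)) := by
    rw [← prod_ite_le_neg_one (Nat.lt_succ_iff.mp l.2), ← Finset.prod_mul_distrib]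
    refine Finset.prod_congr rfl fun i _ => ?_
    have : l < l.succAbove i ↔ (l : ℕ) ≤ i := by
      rw [Fin.lt_succAbove_iff_le_castSucc, Fin.le_def, Fin.val_castSucc]
    simp only [this]
    split_ifs <;> ring
  have h1 : ∏ i : Fin k, (a l - a (l.succAbove i)) ≠ 0 :=
    Finset.prod_ne_zero_iff.mpr fun i _ =>
      sub_ne_zero.mpr fun h => Fin.succAbove_ne l i (ha h).symm
  have h2 : ∏ i : Fin k, (a l + a (l.succAbove i)) ≠ 0 :=
    Finset.prod_ne_zero_iff.mpr fun i _ => (add_pos (hpos _) (hpos _)).ne'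
  have h3 := (hpos l).ne'
  unfold pairRatio
  rw [prod_Ioi_eq_succAbove_mul (fun i j => a j - a i) l,
    prod_Ioi_eq_succAbove_mul (fun i j => a i + a j) l, Fin.prod_univ_succAbove _ l, hadd, hsub]
  field_simp

/-- The closed form satisfies the recursion obtained by expanding the determinant along its last
row and integrating out the largest variable. -/
theorem sum_neg_one_pow_mul_pairRatio_succAbove {k : ℕ} {a : Fin (k + 1) → ℝ}
    (hpos : ∀ i, 0 < a i) (ha : Function.Injective a) :
    ∑ l : Fin (k + 1), (-1) ^ (k + l : ℕ) * pairRatio (fun i => a (l.succAbove i)) =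
      pairRatio a * ∑ l, a l := by
  simp_rw [neg_one_pow_mul_pairRatio_succAbove hpos ha]
  rw [← Finset.mul_sum, sum_mul_prod_add_div_sub ha]

theorem pairRatio_eq_zero_of_not_injective {k : ℕ} {a : Fin k → ℝ}
    (ha : ¬ Function.Injective a) : pairRatio a = 0 := by
  have h : ∏ i : Fin k, ∏ j ∈ Finset.Ioi i, (a j - a i) = 0 := by
    rw [← Matrix.det_vandermonde, Matrix.det_vandermonde_eq_zero_iff]
    simpa [Function.Injective] using ha
  rw [pairRatio, h, zero_div]

/-! ### Ordered simplices and their largest coordinate -/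

/-- The ordered simplex `0 < x_1 < ⋯ < x_k < t`. -/
def orderedSimplexBelow (k : ℕ) (t : ℝ) : Set (Fin k → ℝ) :=
  {x | (∀ i, 0 < x i) ∧ StrictMono x ∧ ∀ i, x i < t}

theorem measurableSet_orderedSimplexBelow_prod (k : ℕ) :
    MeasurableSet {p : ℝ × (Fin k → ℝ) | p.2 ∈ orderedSimplexBelow k p.1} := by
  have h : {p : ℝ × (Fin k → ℝ) | p.2 ∈ orderedSimplexBelow k p.1} =
      (⋂ i, {p | 0 < p.2 i}) ∩ (⋂ i, ⋂ j, ⋂ _ : i < j, {p | p.2 i < p.2 j}) ∩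
        ⋂ i, {p | p.2 i < p.1} := by
    ext p
    simp [orderedSimplexBelow, StrictMono, and_assoc]
  rw [h]
  have hc : ∀ i, Measurable fun p : ℝ × (Fin k → ℝ) => p.2 i := fun i => by fun_prop
  refine ((MeasurableSet.iInter fun i => measurableSet_lt measurable_const (hc i)).inter
    (MeasurableSet.iInter fun i => MeasurableSet.iInter fun j => MeasurableSet.iInter fun _ =>
      measurableSet_lt (hc i) (hc j))).inter
    (MeasurableSet.iInter fun i => measurableSet_lt (hc i) measurable_fst)

theorem measurableSet_orderedSimplexBelow (k : ℕ) (t : ℝ) :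
    MeasurableSet (orderedSimplexBelow k t) :=
  (measurableSet_orderedSimplexBelow_prod k).preimage (measurable_prodMk_left (x := t))

theorem orderedSimplexBelow_mono (k : ℕ) {s t : ℝ} (h : s ≤ t) :
    orderedSimplexBelow k s ⊆ orderedSimplexBelow k t :=
  fun _ hx => ⟨hx.1, hx.2.1, fun i => (hx.2.2 i).trans_le h⟩

/-- Pairs `(s, y)` with `0 < s < t` and `y` in the ordered simplex below `s`: the ordered simplex
below `t` with its largest coordinate split off. -/
def nestedSimplex (k : ℕ) (t : ℝ) : Set (ℝ × (Fin k → ℝ)) :=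
  {p | p.1 ∈ Set.Ioo 0 t ∧ p.2 ∈ orderedSimplexBelow k p.1}

theorem measurableSet_nestedSimplex (k : ℕ) (t : ℝ) : MeasurableSet (nestedSimplex k t) :=
  (measurableSet_Ioo.preimage measurable_fst).inter (measurableSet_orderedSimplexBelow_prod k)

theorem piFinSuccAbove_last_apply {k : ℕ} (x : Fin (k + 1) → ℝ) :
    MeasurableEquiv.piFinSuccAbove (fun _ => ℝ) (Fin.last k) x =
      (x (Fin.last k), fun i => x i.castSucc) := by
  ext <;> simp [MeasurableEquiv.piFinSuccAbove, Fin.init]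

theorem piFinSuccAbove_preimage_nestedSimplex (k : ℕ) (t : ℝ) :
    MeasurableEquiv.piFinSuccAbove (fun _ => ℝ) (Fin.last k) ⁻¹' nestedSimplex k t =
      orderedSimplexBelow (k + 1) t := by
  ext x
  rw [Set.mem_preimage, piFinSuccAbove_last_apply]
  constructor
  · rintro ⟨⟨h0, ht⟩, hy0, hmono, hlt⟩
    refine ⟨Fin.lastCases h0 hy0, ?_, Fin.lastCases ht fun i => (hlt i).trans ht⟩
    intro i j
    induction j using Fin.lastCases with
    | last =>
      induction i using Fin.lastCases with
      | last => exact fun h => absurd h (lt_irrefl _)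
      | cast i => exact fun _ => hlt i
    | cast j =>
      induction i using Fin.lastCases with
      | last => exact fun h => absurd h (Fin.castSucc_lt_last j).not_gt
      | cast i => exact fun h => hmono h
  · rintro ⟨h0, hmono, ht⟩
    exact ⟨⟨h0 _, ht _⟩, fun i => h0 _, fun i j h => hmono (Fin.castSucc_lt_castSucc_iff.mpr h),
      fun i => hmono (Fin.castSucc_lt_last i)⟩

theorem integrableOn_rpow_mul_nestedSimplex {k : ℕ} {t c : ℝ} (hc : 0 < c)
    {g : (Fin k → ℝ) → ℝ} (hg : IntegrableOn g (orderedSimplexBelow k t)) :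
    IntegrableOn (fun p : ℝ × (Fin k → ℝ) => p.1 ^ (c - 1) * g p.2) (nestedSimplex k t) := by
  have hf : IntegrableOn (fun s : ℝ => s ^ (c - 1)) (Set.Ioo 0 t) := by
    rcases le_or_gt t 0 with h | h
    · simp [Set.Ioo_eq_empty h.not_gt]
    · exact (intervalIntegral.integrableOn_Ioo_rpow_iff h).mpr (by linarith)
  have h := Integrable.mul_prod hf hg
  rw [Measure.prod_restrict] at h
  refine IntegrableOn.mono_set h fun p hp => ⟨hp.1, ?_⟩
  exact orderedSimplexBelow_mono k hp.1.2.le hp.2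

/-- If the integrals of `g` over the simplices below `s` scale as `s ^ d`, then the integral over
the nested simplex is a one-variable power integral. -/
theorem integral_rpow_mul_nestedSimplex {k : ℕ} {t c d C : ℝ} (ht : 0 < t) (hc : 0 < c)
    (hd : 0 ≤ d) {g : (Fin k → ℝ) → ℝ} (hg : IntegrableOn g (orderedSimplexBelow k t))
    (hI : ∀ s, 0 < s → ∫ y in orderedSimplexBelow k s, g y = s ^ d * C) :
    ∫ p in nestedSimplex k t, p.1 ^ (c - 1) * g p.2 = t ^ (c + d) / (c + d) * C := by
  have hint := integrableOn_rpow_mul_nestedSimplex hc hg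
  rw [← integral_indicator (measurableSet_nestedSimplex k t), Measure.volume_eq_prod,
    integral_prod _ ((integrable_indicator_iff (measurableSet_nestedSimplex k t)).mpr hint)]
  have hinner : ∀ s : ℝ, ∫ y, (nestedSimplex k t).indicator
      (fun p : ℝ × (Fin k → ℝ) => p.1 ^ (c - 1) * g p.2) (s, y) =
      (Set.Ioo 0 t).indicator (fun s => s ^ (c + d - 1) * C) s := by
    intro s
    by_cases hs : s ∈ Set.Ioo 0 t
    · rw [Set.indicator_of_mem hs]
      have : ∀ y, (nestedSimplex k t).indicator
          (fun p : ℝ × (Fin k → ℝ) => p.1 ^ (c - 1) * g p.2) (s, y) =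
          (orderedSimplexBelow k s).indicator (fun y => s ^ (c - 1) * g y) y := by
        intro y
        by_cases hy : y ∈ orderedSimplexBelow k s
        · have hmem : (s, y) ∈ nestedSimplex k t := ⟨hs, hy⟩
          rw [Set.indicator_of_mem hy, Set.indicator_of_mem hmem]
        · rw [Set.indicator_of_notMem hy, Set.indicator_of_notMem fun h => hy h.2]
      simp_rw [this]
      rw [integral_indicator (measurableSet_orderedSimplexBelow k s), integral_const_mul,
        hI s hs.1, ← mul_assoc, ← Real.rpow_add hs.1]
      ring_nf
    · rw [Set.indicator_of_notMem hs]
      have : ∀ y, (nestedSimplex k t).indicator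
          (fun p : ℝ × (Fin k → ℝ) => p.1 ^ (c - 1) * g p.2) (s, y) = 0 := fun y =>
        Set.indicator_of_notMem (fun h => hs h.1) _
      simp [this]
  simp_rw [hinner]
  rw [integral_indicator measurableSet_Ioo, integral_mul_const, ← integral_Ioc_eq_integral_Ioo,
    ← intervalIntegral.integral_of_le ht.le, integral_rpow (Or.inl (by linarith)), sub_add_cancel,
    Real.zero_rpow (by linarith), sub_zero]

/-- Expansion along the last row. -/
theorem det_powerMatrix_succ {k : ℕ} (a x : Fin (k + 1) → ℝ) :
    (powerMatrix a x).det = ∑ l : Fin (k + 1), (-1) ^ (k + l : ℕ) *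
      (x (Fin.last k) ^ (a l - 1) *
        (powerMatrix (fun i => a (l.succAbove i)) fun i => x i.castSucc).det) := by
  rw [Matrix.det_succ_row _ (Fin.last k)]
  refine Finset.sum_congr rfl fun l _ => ?_
  rw [mul_assoc, Fin.val_last, Fin.succAbove_last]
  rfl

/-- The scaled form of the integral formula: on the simplex below `t` the integral picks up the
factor `t ^ ∑ a_i`, which makes it amenable to induction on the dimension. -/
theorem integral_det_powerMatrix_below {k : ℕ} (a : Fin k → ℝ) (hpos : ∀ i, 0 < a i) (t : ℝ)
    (ht : 0 < t) :
    IntegrableOn (fun x => (powerMatrix a x).det) (orderedSimplexBelow k t) ∧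
      ∫ x in orderedSimplexBelow k t, (powerMatrix a x).det =
        t ^ (∑ i, a i) * pairRatio a := by
  induction k generalizing t with
  | zero =>
    have hS : orderedSimplexBelow 0 t = Set.univ := by
      ext x
      simp [orderedSimplexBelow, Subsingleton.strictMono]
    simp [hS, pairRatio, Measure.real, volume_pi, Measure.pi_empty_univ]
  | succ k ih =>
    have hint := fun l : Fin (k + 1) => integrableOn_rpow_mul_nestedSimplex (hpos l)
      (ih (fun i => a (l.succAbove i)) (fun i => hpos _) t ht).1
    have hpres := volume_preserving_piFinSuccAbove (fun _ : Fin (k + 1) => ℝ) (Fin.last k)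
    have hemb := (MeasurableEquiv.piFinSuccAbove (fun _ : Fin (k + 1) => ℝ)
      (Fin.last k)).measurableEmbedding
    set F : ℝ × (Fin k → ℝ) → ℝ := fun p => ∑ l : Fin (k + 1), (-1) ^ (k + l : ℕ) *
      (p.1 ^ (a l - 1) * (powerMatrix (fun i => a (l.succAbove i)) p.2).det) with hF
    have hdet : (fun x => (powerMatrix a x).det) =
        F ∘ MeasurableEquiv.piFinSuccAbove (fun _ => ℝ) (Fin.last k) := by
      funext x
      simp only [det_powerMatrix_succ, hF, Function.comp, piFinSuccAbove_last_apply]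
    have hFint : IntegrableOn F (nestedSimplex k t) :=
      integrable_finsetSum _ fun l _ => (hint l).const_mul _
    refine ⟨?_, ?_⟩
    · rw [hdet, ← piFinSuccAbove_preimage_nestedSimplex]
      exact (hpres.integrableOn_comp_preimage hemb).mpr hFint
    · by_cases ha : Function.Injective a
      · have hcomp : ∫ x in orderedSimplexBelow (k + 1) t, (powerMatrix a x).det =
            ∫ p in nestedSimplex k t, F p := by
          rw [← piFinSuccAbove_preimage_nestedSimplex, hdet]
          exact hpres.setIntegral_preimage_emb hemb F _
        have hsum : ∀ l, a l + ∑ i : Fin k, a (l.succAbove i) = ∑ i, a i := fun l =>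
          (Fin.sum_univ_succAbove a l).symm
        have hS : 0 < ∑ i, a i := Finset.sum_pos (fun i _ => hpos i) Finset.univ_nonempty
        rw [hcomp, hF, integral_finsetSum _ fun l _ => (hint l).const_mul _]
        simp_rw [integral_const_mul]
        have hterm : ∀ l : Fin (k + 1), ∫ p in nestedSimplex k t, p.1 ^ (a l - 1) *
            (powerMatrix (fun i => a (l.succAbove i)) p.2).det =
            t ^ (∑ i, a i) / (∑ i, a i) * pairRatio (fun i => a (l.succAbove i)) := by
          intro l
          rw [integral_rpow_mul_nestedSimplex ht (hpos l)
            (Finset.sum_nonneg fun i _ => (hpos (l.succAbove i)).le)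
            (ih _ (fun i => hpos _) t ht).1 fun s hs => (ih _ (fun i => hpos _) s hs).2, hsum]
        simp_rw [hterm, mul_left_comm _ (t ^ (∑ i, a i) / (∑ i, a i))]
        rw [← Finset.mul_sum, sum_neg_one_pow_mul_pairRatio_succAbove hpos ha]
        field_simp
      · -- Two equal exponents give two equal columns, and both sides vanish.
        have hzero : ∀ x, (powerMatrix a x).det = 0 := fun x => by
          obtain ⟨i, j, hij, hne⟩ := Function.not_injective_iff.mp ha
          exact Matrix.det_zero_of_column_eq hne fun m => by simp [powerMatrix, hij]
        simp [hzero, pairRatio_eq_zero_of_not_injective ha]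

theorem orderedSimplex_eq_below_one (k : ℕ) : orderedSimplex k = orderedSimplexBelow k 1 := rfl

theorem det_powerMatrix_add_one {k : ℕ} (x : Fin k → ℝ) :
    (powerMatrix (fun j : Fin k => (j : ℝ) + 1) x).det =
      ∏ i : Fin k, ∏ j ∈ Finset.Ioi i, (x j - x i) := by
  rw [← Matrix.det_vandermonde]
  congr 1
  ext i j
  simp [powerMatrix, Matrix.vandermonde_apply]

theorem mainTheorem1 (k : ℕ) :
    (∀ a : Fin k → ℝ, (∀ i, 0 < a i) →
      IntegrableOn (fun x : Fin k → ℝ => (powerMatrix a x).det) (orderedSimplex k) volume ∧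
      ∫ x in orderedSimplex k, (powerMatrix a x).det =
        (∏ i : Fin k, ∏ j ∈ Finset.Ioi i, (a j - a i)) /
          ((∏ i : Fin k, a i) * ∏ i : Fin k, ∏ j ∈ Finset.Ioi i, (a i + a j))) ∧
    (∀ x ∈ orderedSimplex k,
      (powerMatrix (fun j : Fin k => (j : ℝ) + 1) x).det =
        ∏ i : Fin k, ∏ j ∈ Finset.Ioi i, (x j - x i)) ∧
    IntegrableOn (fun x : Fin k → ℝ => ∏ i : Fin k, ∏ j ∈ Finset.Ioi i, (x j - x i))
      (orderedSimplex k) volume ∧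
    ∫ x in orderedSimplex k, (∏ i : Fin k, ∏ j ∈ Finset.Ioi i, (x j - x i)) =
      (∏ i : Fin k, ∏ j ∈ Finset.Ioi i, ((j : ℝ) - (i : ℝ))) /
        ((∏ i : Fin k, ((i : ℝ) + 1)) *
          ∏ i : Fin k, ∏ j ∈ Finset.Ioi i, (((i : ℝ) + 1) + ((j : ℝ) + 1))) := by
  have main : ∀ a : Fin k → ℝ, (∀ i, 0 < a i) →
      IntegrableOn (fun x : Fin k → ℝ => (powerMatrix a x).det) (orderedSimplex k) volume ∧
      ∫ x in orderedSimplex k, (powerMatrix a x).det = pairRatio a := by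
    intro a ha
    simpa [orderedSimplex_eq_below_one] using integral_det_powerMatrix_below a ha 1 one_pos
  obtain ⟨hint, hval⟩ := main (fun j : Fin k => (j : ℝ) + 1) fun i => by positivity
  simp only [det_powerMatrix_add_one] at hint hval
  refine ⟨main, fun x _ => det_powerMatrix_add_one x, hint, ?_⟩
  rw [hval]
  simp only [pairRatio, add_sub_add_right_eq_sub]
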